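/- All spaces are over the real scalars. For a Banach space $X$ let $X^*$ be its dual and let $\partial_e X^*_1$ be the set of extreme points of the closed unit ball $X^*_1$ of $X^*$. A non-zero $x\in X$ is a smooth point if there is exactly one $x^*\in X^*$ with $\|x^*\|=1$ and $x^*(x)=\|x\|$; it is a very smooth point if it is a smooth point of $X$ and its canonical image is a smooth point of $X^{**}$. For a unit vector $x$ put $S_x=\{x^*\in X^*_1 : x^*(x)=1\}$; a unit vector $x$ is a quasi-polyhedral (QP) point if there is $\delta>0$ such that $S_z\subseteq S_x$ for every unit vector $z$ with $\|z-x\|<\delta$. $X$ is an $L^1$-predual space if $X^*$ is linearly isometric to $L^1(\mu)$ for some positive measure $\mu$. Theorem 4. Let $X$ be a real Banach space such that for every $x^*\in\partial_e X^*_1$ the subspace $\operatorname{span}\{x^*\}$ is an $L$-summand of $X^*$, i.e. there is a closed subspace $N\subseteq X^*$ with $X^*=\operatorname{span}\{x^*\}\oplus N$ and $\|y+n\|=\|y\|+\|n\|$ for all $y\in\operatorname{span}\{x^*\}$, $n\in N$. Let $x\in X$ be a unit vector which is a very smooth point. Then $x$ is a QP point of $X$. If $X$ is moreover an $L^1$-predual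 space, then for every $n\ge 0$ the canonical image of $x$ in the dual $X^{(2n)}$ of order $2n$ of $X$ (where $X^{(0)}=X$ and $X^{(2n+2)}=(X^{(2n)})^{**}$) is a QP point of $X^{(2n)}$. -/

import Mathlib

open MeasureTheory

universe u v

noncomputable section

/-- A non-zero vector `x` of a real normed space is a smooth point if there is exactly one
norm-one functional `f` with `f x = ‖x‖`. -/
def IsSmoothPoint {X : Type u} [NormedAddCommGroup X] [NormedSpace ℝ X] (x : X) : Prop :=
  x ≠ 0 ∧ ∃! f : StrongDual ℝ X, ‖f‖ = 1 ∧ f x = ‖x‖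

/-- A smooth point is very smooth if its canonical image is also a smooth point of the bidual. -/
def IsVerySmoothPoint {X : Type u} [NormedAddCommGroup X] [NormedSpace ℝ X] (x : X) : Prop :=
  IsSmoothPoint x ∧ IsSmoothPoint (NormedSpace.inclusionInDoubleDual ℝ X x)

/-- The state space `S_x = {f : ‖f‖ ≤ 1, f x = 1}` (used for unit vectors `x`). -/
def stateSpace {X : Type u} [NormedAddCommGroup X] [NormedSpace ℝ X] (x : X) :
    Set (StrongDual ℝ X) :=
  {f | ‖f‖ ≤ 1 ∧ f x = 1}

/-- A unit vector `x` is a quasi-polyhedral point if `S_z ⊆ S_x` for all unit vectors `z` that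
are close enough to `x`. -/
def IsQPPoint {X : Type u} [NormedAddCommGroup X] [NormedSpace ℝ X] (x : X) : Prop :=
  ‖x‖ = 1 ∧ ∃ δ : ℝ, 0 < δ ∧
    ∀ z : X, ‖z‖ = 1 → ‖z - x‖ < δ → stateSpace z ⊆ stateSpace x

/-- `M` is an `L`-summand of `E`: `E` is the `ℓ¹`-direct sum of the closed subspaces `M` and `N`,
for some `N`. -/
def IsLSummand {E : Type u} [NormedAddCommGroup E] [NormedSpace ℝ E]
    (M : Submodule ℝ E) : Prop :=
  IsClosed (M : Set E) ∧ ∃ N : Submodule ℝ E, IsClosed (N : Set E) ∧ IsCompl M N ∧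
    ∀ m ∈ M, ∀ n ∈ N, ‖m + n‖ = ‖m‖ + ‖n‖

/-- `X` is an `L¹`-predual: its dual is linearly isometric to `L¹(μ)` for some positive
measure `μ`. -/
def IsL1Predual (X : Type u) [NormedAddCommGroup X] [NormedSpace ℝ X] : Prop :=
  ∃ (Ω : Type v) (_ : MeasurableSpace Ω) (μ : Measure Ω),
    Nonempty (StrongDual ℝ X ≃ₗᵢ[ℝ] Lp ℝ 1 μ)

/-- A bundled real normed space, used only to iterate the passage to the bidual. -/
structure RealNormedSpace where
  carrier : Type u
  [group : NormedAddCommGroup carrier]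
  [space : NormedSpace ℝ carrier]

attribute [instance] RealNormedSpace.group RealNormedSpace.space

/-- The bundled form of the dual of order `2 * n` of `X`. -/
def evenDualBundled (X : Type u) [NormedAddCommGroup X] [NormedSpace ℝ X] :
    ℕ → RealNormedSpace.{u}
  | 0 => ⟨X⟩
  | n + 1 => ⟨StrongDual ℝ (StrongDual ℝ (evenDualBundled X n).carrier)⟩

/-- The dual of order `2 * n` of `X`, i.e. `X`, `X**`, `X****`, ... -/
abbrev EvenDual (X : Type u) [NormedAddCommGroup X] [NormedSpace ℝ X] (n : ℕ) : Type u :=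
  (evenDualBundled X n).carrier

/-- The canonical embedding of `X` into its dual of order `2 * n`: the composition of the
canonical embeddings of each even dual into its bidual. -/
def evenDualEmbedding (X : Type u) [NormedAddCommGroup X] [NormedSpace ℝ X] :
    (n : ℕ) → X →ₗᵢ[ℝ] EvenDual X n
  | 0 => LinearIsometry.id
  | n + 1 => (NormedSpace.inclusionInDoubleDualLi ℝ (E := EvenDual X n)).comp
      (evenDualEmbedding X n)

end

/-! Very smoothness forces the norm to be linear near `x`. The state `f` of `x` is extreme, so it
spans an L-summand with coordinate `φ` in the bidual, and `f` is the only extreme point of the dual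
ball where `φ > 0`. Since `φ` need not be weak*-continuous, compactness is used one level up:
smoothness of `x` in the bidual keeps functionals with `φ ≤ 0` away from norming `x`. So for `z`
near `x`, any extreme functional norming `z` is `f`. Local linearity yields QP and passes to
biduals. -/

section LocallyLinearNorm

variable {E : Type*} [NormedAddCommGroup E] [NormedSpace ℝ E]

/-- The functional giving the coordinate of an `L`-projection onto a line. -/
theorem IsLSummand.exists_coord {f : E} (hf : f ≠ 0)
    (h : IsLSummand (Submodule.span ℝ {f})) :
    ∃ φ : StrongDual ℝ E, φ f = 1 ∧ ∀ g, ‖g‖ = |φ g| * ‖f‖ + ‖g - φ g • f‖ := by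
  obtain ⟨-, N, -, hc, hn⟩ := h
  let ψ : E →ₗ[ℝ] ℝ := (LinearEquiv.coord ℝ E f hf).toLinearMap ∘ₗ
    Submodule.projectionOnto (Submodule.span ℝ {f}) N hc
  have hψ : ∀ g, ψ g • f = (Submodule.projectionOnto _ N hc g : E) := fun g =>
    LinearEquiv.coord_apply_smul ℝ E f hf _
  have hf1 : ψ f = 1 := by
    have h1 := hψ f
    rw [Submodule.projectionOnto_apply_left hc
      ⟨f, Submodule.mem_span_singleton_self f⟩] at h1
    exact smul_left_injective ℝ hf (by simpa using h1)
  have hnorm : ∀ g, ‖g‖ = |ψ g| * ‖f‖ + ‖g - ψ g • f‖ := by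
    intro g
    have hmem : g - ψ g • f ∈ N := by
      rw [← Submodule.ker_projectionOnto hc, LinearMap.mem_ker, map_sub, hψ,
        Submodule.projectionOnto_apply_left, sub_self]
    have := hn (ψ g • f) (Submodule.smul_mem _ _ (Submodule.mem_span_singleton_self f)) _ hmem
    rwa [add_sub_cancel, norm_smul, Real.norm_eq_abs] at this
  refine ⟨ψ.mkContinuous ‖f‖⁻¹ fun g => ?_, hf1, hnorm⟩
  have hpos := norm_pos_iff.2 hf
  rw [inv_mul_eq_div, le_div_iff₀ hpos, Real.norm_eq_abs, hnorm g]
  exact le_add_of_nonneg_right (norm_nonneg _)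

/-- An extreme point of the unit ball with positive coordinate along an `L`-summand spanned by a
unit vector equals this vector. -/
theorem eq_of_mem_extremePoints_of_coord_pos {f e : E} {φ : E → ℝ} (hf : ‖f‖ = 1)
    (hφ : ∀ g, ‖g‖ = |φ g| * ‖f‖ + ‖g - φ g • f‖)
    (he : e ∈ (Metric.closedBall (0 : E) 1).extremePoints ℝ) (hpos : 0 < φ e) : e = f := by
  have he1 : ‖e‖ ≤ 1 := by simpa using he.1
  have hsum := hφ e
  rw [hf, abs_of_pos hpos, mul_one] at hsum
  rcases lt_or_ge (φ e) 1 with hlt | hge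
  · have h1 : 0 < 1 - φ e := sub_pos.2 hlt
    -- Otherwise `e` is a proper convex combination of `f` and this normalised remainder.
    have hr : (1 - φ e)⁻¹ • (e - φ e • f) ∈ Metric.closedBall (0 : E) 1 := by
      rw [mem_closedBall_zero_iff, norm_smul, norm_inv, Real.norm_of_nonneg h1.le,
        inv_mul_le_iff₀ h1]
      linarith
    refine ((mem_extremePoints.1 he).2 f (by simp [hf]) _ hr
      ⟨φ e, 1 - φ e, hpos, h1, by ring, ?_⟩).1.symm
    rw [smul_inv_smul₀ h1.ne', add_sub_cancel]
  · have h0 : ‖e - φ e • f‖ = 0 := le_antisymm (by linarith) (norm_nonneg _)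
    have h1 : φ e = 1 := by linarith
    rwa [norm_eq_zero, sub_eq_zero, h1, one_smul] at h0

/-- Functionals in the dual unit ball which are nonpositive at a vector where the state of a smooth
point is positive are uniformly far from norming that point. -/
theorem IsSmoothPoint.exists_bound_lt {y w : E} (hy : IsSmoothPoint y) {F : StrongDual ℝ E}
    (hF : ‖F‖ = 1) (hFy : F y = ‖y‖) (hw : 0 < F w) :
    ∃ c < ‖y‖, ∀ G : StrongDual ℝ E, ‖G‖ ≤ 1 → G w ≤ 0 → G y ≤ c := by
  let K : Set (WeakDual ℝ E) :=
    (WeakDual.toStrongDual ⁻¹' Metric.closedBall 0 1) ∩ {G | G w ≤ 0}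
  have hK : IsCompact K := (WeakDual.isCompact_closedBall (0 : StrongDual ℝ E) 1).inter_right
    (isClosed_le (WeakDual.eval_continuous w) continuous_const)
  rcases K.eq_empty_or_nonempty with h0 | hne
  · refine ⟨‖y‖ - 1, by linarith, fun G hG hGw => ?_⟩
    have : StrongDual.toWeakDual G ∈ K := ⟨by simpa using hG, hGw⟩
    simp [h0] at this
  obtain ⟨G₀, hG₀, hmax⟩ := hK.exists_isMaxOn hne (WeakDual.eval_continuous y).continuousOn
  refine ⟨G₀ y, ?_, fun G hG hGw =>
    hmax (a := StrongDual.toWeakDual G) ⟨by simpa using hG, hGw⟩⟩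
  have hb : ‖WeakDual.toStrongDual G₀‖ ≤ 1 := by simpa using hG₀.1
  have hypos : 0 < ‖y‖ := norm_pos_iff.2 hy.1
  have hle : ‖WeakDual.toStrongDual G₀ y‖ ≤ ‖WeakDual.toStrongDual G₀‖ * ‖y‖ :=
    ContinuousLinearMap.le_opNorm _ y
  have hle' : G₀ y ≤ ‖WeakDual.toStrongDual G₀‖ * ‖y‖ := (le_abs_self _).trans hle
  refine lt_of_le_of_ne (hle'.trans (mul_le_of_le_one_left hypos.le hb)) fun heq => ?_
  have h1 : ‖WeakDual.toStrongDual G₀‖ = 1 := by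
    refine le_antisymm hb ?_
    rw [heq] at hle'
    exact le_of_mul_le_mul_right (by simpa using hle') hypos
  have h2 : WeakDual.toStrongDual G₀ = F := hy.2.unique ⟨h1, heq⟩ ⟨hF, hFy⟩
  have h3 : F w ≤ 0 := h2 ▸ hG₀.2
  linarith

/-- The norm-one functionals norming a vector include an extreme point of the dual unit ball. -/
theorem exists_mem_extremePoints_apply_eq_norm (z : E) :
    ∃ e ∈ (Metric.closedBall (0 : StrongDual ℝ E) 1).extremePoints ℝ, e z = ‖z‖ := by
  let K : Set (WeakDual ℝ E) :=
    (WeakDual.toStrongDual ⁻¹' Metric.closedBall 0 1) ∩ {G | G z = ‖z‖}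
  have hK : IsCompact K := (WeakDual.isCompact_closedBall (0 : StrongDual ℝ E) 1).inter_right
    (isClosed_eq (WeakDual.eval_continuous z) continuous_const)
  have hne : K.Nonempty := by
    obtain ⟨g, hg, hgz⟩ := exists_dual_vector'' ℝ z
    exact ⟨StrongDual.toWeakDual g, by simpa using hg, hgz⟩
  have : LocallyConvexSpace ℝ (WeakDual ℝ E) :=
    WeakBilin.locallyConvexSpace (B := topDualPairing ℝ E)
  obtain ⟨e, he⟩ := hK.extremePoints_nonempty hne
  have hmem : ∀ g : StrongDual ℝ E, ‖g‖ ≤ 1 → g z ≤ ‖z‖ := fun g hg =>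
    (le_abs_self _).trans ((g.le_opNorm z).trans (mul_le_of_le_one_left (norm_nonneg z) hg))
  refine ⟨WeakDual.toStrongDual e, mem_extremePoints.2 ⟨he.1.1, ?_⟩, he.1.2⟩
  -- `K` is a face of the ball, so its extreme points are extreme in the ball.
  rintro g hg g' hg' ⟨a, b, ha, hb, hab, heq⟩
  have hz : a * g z + b * g' z = ‖z‖ := by
    have := congrArg (fun G : StrongDual ℝ E => G z) heq
    exact this.trans he.1.2
  have h1 := hmem g (by simpa using hg)
  have h2 := hmem g' (by simpa using hg')
  have h3 := mul_le_mul_of_nonneg_left h1 ha.le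
  have h4 := mul_le_mul_of_nonneg_left h2 hb.le
  have h5 : a * ‖z‖ + b * ‖z‖ = ‖z‖ := by rw [← add_mul, hab, one_mul]
  have hgz : g z = ‖z‖ := by
    refine le_antisymm h1 (le_of_mul_le_mul_left ?_ ha)
    linarith
  have hgz' : g' z = ‖z‖ := by
    refine le_antisymm h2 (le_of_mul_le_mul_left ?_ hb)
    linarith
  exact (mem_extremePoints.1 he).2 (StrongDual.toWeakDual g) ⟨hg, hgz⟩
    (StrongDual.toWeakDual g') ⟨hg', hgz'⟩ ⟨a, b, ha, hb, hab, heq⟩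

/-- The unique norm-one functional at a smooth point is an extreme point of the dual unit ball. -/
theorem IsSmoothPoint.mem_extremePoints {y : E} (hy : IsSmoothPoint y) {F : StrongDual ℝ E}
    (hF : ‖F‖ = 1) (hFy : F y = ‖y‖) :
    F ∈ (Metric.closedBall (0 : StrongDual ℝ E) 1).extremePoints ℝ := by
  obtain ⟨e, he, hey⟩ := exists_mem_extremePoints_apply_eq_norm y
  have hb : ‖e‖ ≤ 1 := by simpa using he.1
  have hpos : 0 < ‖y‖ := norm_pos_iff.2 hy.1
  have hge : 1 ≤ ‖e‖ := by
    have h := (le_abs_self _).trans (e.le_opNorm y)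
    rw [hey] at h
    exact le_of_mul_le_mul_right (by simpa using h) hpos
  rwa [hy.2.unique ⟨hF, hFy⟩ ⟨le_antisymm hb hge, hey⟩]

/-- The norm agrees with a functional of norm at most one in a neighbourhood of `x`. -/
def NormLocallyLinearAt (x : E) : Prop :=
  ∃ f : StrongDual ℝ E, ‖f‖ ≤ 1 ∧ ∃ δ > 0, ∀ z, ‖z - x‖ < δ → ‖z‖ ≤ f z

theorem IsVerySmoothPoint.normLocallyLinearAt
    (hE : ∀ f ∈ (Metric.closedBall (0 : StrongDual ℝ E) 1).extremePoints ℝ,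
      IsLSummand (Submodule.span ℝ {f}))
    {x : E} (hx : IsVerySmoothPoint x) : NormLocallyLinearAt x := by
  obtain ⟨f, ⟨hf, hfx⟩, -⟩ := hx.1.2
  have hf0 : f ≠ 0 := norm_pos_iff.1 (by rw [hf]; exact one_pos)
  obtain ⟨φ, hφf, hφ⟩ := (hE f (hx.1.mem_extremePoints hf hfx)).exists_coord hf0
  let J (g : StrongDual ℝ E) := NormedSpace.inclusionInDoubleDualLi ℝ (E := StrongDual ℝ E) g
  have hJ : ∀ g, ‖J g‖ = ‖g‖ := fun g => LinearIsometry.norm_map _ g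
  have hx' : ‖NormedSpace.inclusionInDoubleDual ℝ E x‖ = ‖x‖ :=
    (NormedSpace.inclusionInDoubleDualLi ℝ (E := E)).norm_map x
  obtain ⟨c, hc, hbound⟩ := hx.2.exists_bound_lt (F := J f) (w := φ) ((hJ f).trans hf)
    (hfx.trans hx'.symm) (by change 0 < φ f; rw [hφf]; exact one_pos)
  rw [hx'] at hc
  -- This radius gives `e x ≥ ‖z‖ - ‖z - x‖ ≥ ‖x‖ - 2 * ‖z - x‖ > c`.
  refine ⟨f, hf.le, (‖x‖ - c) / 2, by linarith, fun z hz => ?_⟩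
  obtain ⟨e, he, hez⟩ := exists_mem_extremePoints_apply_eq_norm z
  have hb : ‖e‖ ≤ 1 := by simpa using he.1
  have h1 : e (z - x) ≤ ‖z - x‖ :=
    (le_abs_self _).trans ((e.le_opNorm _).trans (mul_le_of_le_one_left (norm_nonneg _) hb))
  have h2 : ‖x‖ - ‖z‖ ≤ ‖z - x‖ := by
    rw [norm_sub_rev]
    exact norm_sub_norm_le x z
  rw [map_sub, hez] at h1
  have hpos : 0 < φ e := by
    by_contra! hle
    have h3 : e x ≤ c := hbound (J e) ((hJ e).trans_le hb) hle
    linarith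
  rw [← eq_of_mem_extremePoints_of_coord_pos hf hφ he hpos, hez]

/-- If a state `g` of `z` had `g x < 1`, it would exceed the norm just beyond `z` on the line from
`x`, where the norm equals `f ≤ 1 + t * 0`. -/
theorem NormLocallyLinearAt.isQPPoint {x : E} (h : NormLocallyLinearAt x) (hx : ‖x‖ = 1) :
    IsQPPoint x := by
  obtain ⟨f, hf, δ, hδ, hlin⟩ := h
  refine ⟨hx, δ, hδ, fun z hz hzx g hg => ⟨hg.1, ?_⟩⟩
  have key : ∀ g : StrongDual ℝ E, ‖g‖ ≤ 1 → ∀ w, g w ≤ ‖w‖ := fun g hg w =>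
    (le_abs_self _).trans ((g.le_opNorm w).trans (mul_le_of_le_one_left (norm_nonneg w) hg))
  -- Move slightly beyond `z`, away from `x`.
  obtain ⟨t, ht, htδ⟩ : ∃ t > 0, (1 + t) * ‖z - x‖ < δ := by
    refine ⟨(δ - ‖z - x‖) / (2 * δ), by have := sub_pos.2 hzx; positivity, ?_⟩
    have h0 := norm_nonneg (z - x)
    have : (δ - ‖z - x‖) / (2 * δ) * ‖z - x‖ ≤ (δ - ‖z - x‖) / 2 := by
      rw [div_mul_eq_mul_div, div_le_div_iff₀ (by positivity) two_pos]
      nlinarith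
    linarith
  have h1 : ‖x + (1 + t) • (z - x)‖ ≤ f (x + (1 + t) • (z - x)) := by
    apply hlin
    rwa [add_sub_cancel_left, norm_smul, Real.norm_of_nonneg (by linarith)]
  have h2 := (key g hg.1 _).trans h1
  have h3 := hlin x (by simpa using hδ)
  have h4 := key f hf z
  have h5 := key g hg.1 x
  have h6 := hg.2
  simp only [map_add, map_smul, map_sub, smul_eq_mul] at h2
  rw [h6] at h2
  have h7 := key f hf x
  rw [hx] at h3 h5 h7
  rw [hz] at h4
  nlinarith

/-- Local linearity yields the strong exposure estimate `δ * ‖g - f‖ ≤ (f - g) x` on the dual ball.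
Any bidual element within `δ` of `x` is then maximised on that ball at `f`, so the same `δ` works.
-/
theorem NormLocallyLinearAt.inclusionInDoubleDual {x : E} (h : NormLocallyLinearAt x) :
    NormLocallyLinearAt (NormedSpace.inclusionInDoubleDualLi ℝ (E := E) x) := by
  obtain ⟨f, hf, δ, hδ, hlin⟩ := h
  have strong : ∀ g : StrongDual ℝ E, ‖g‖ ≤ 1 → δ * ‖g - f‖ ≤ (f - g) x := by
    intro g hg
    have hball : ∀ w : E, ‖w‖ < δ → (g - f) w ≤ (f - g) x := by
      intro w hw
      have h1 := hlin (x + w) (by simpa using hw)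
      have h2 : g (x + w) ≤ ‖x + w‖ := (le_abs_self _).trans
        ((g.le_opNorm _).trans (mul_le_of_le_one_left (norm_nonneg _) hg))
      simp only [map_add, sub_apply] at *
      linarith
    rw [mul_comm, ← le_div_iff₀ hδ]
    by_contra! hlt
    obtain ⟨w, hw, hgw⟩ := ContinuousLinearMap.exists_lt_apply_of_lt_opNorm _ hlt
    rw [div_lt_iff₀ hδ, Real.norm_eq_abs] at hgw
    have hδw : ‖δ • w‖ < δ := by
      rw [norm_smul, Real.norm_of_nonneg hδ.le]
      exact mul_lt_of_lt_one_right hδ hw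
    have h1 := hball (δ • w) hδw
    have h2 := hball (-(δ • w)) (by rwa [norm_neg])
    rw [map_neg, map_smul, smul_eq_mul] at h2
    rw [map_smul, smul_eq_mul] at h1
    rcases abs_cases ((g - f) w) with h | h <;> nlinarith
  refine ⟨NormedSpace.inclusionInDoubleDualLi ℝ (E := StrongDual ℝ E) f,
    (LinearIsometry.norm_map _ f).trans_le hf, δ, hδ, fun z hz => ?_⟩
  have hle : ∀ g : StrongDual ℝ E, ‖g‖ ≤ 1 → z g ≤ z f := by
    intro g hg
    have h1 := strong g hg
    have h2 : z (g - f) - (g - f) x ≤ δ * ‖g - f‖ := (le_abs_self _).trans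
      (((z - NormedSpace.inclusionInDoubleDualLi ℝ (E := E) x).le_opNorm (g - f)).trans
        (mul_le_mul_of_nonneg_right hz.le (norm_nonneg _)))
    simp only [map_sub, sub_apply] at h1 h2
    linarith
  change ‖z‖ ≤ z f
  by_contra! hlt
  obtain ⟨g, hg, hgz⟩ := ContinuousLinearMap.exists_lt_apply_of_lt_opNorm _ hlt
  have h1 := hle g hg.le
  have h2 := hle (-g) (by rw [norm_neg]; exact hg.le)
  rw [map_neg] at h2
  rw [Real.norm_eq_abs] at hgz
  exact hgz.not_ge (abs_le'.2 ⟨h1, h2⟩)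

theorem NormLocallyLinearAt.evenDualEmbedding {X : Type*} [NormedAddCommGroup X]
    [NormedSpace ℝ X] {x : X} (h : NormLocallyLinearAt x) :
    ∀ n : ℕ, NormLocallyLinearAt (evenDualEmbedding X n x)
  | 0 => h
  | n + 1 => (NormLocallyLinearAt.evenDualEmbedding h n).inclusionInDoubleDual

end LocallyLinearNorm

theorem theorem4 {X : Type u} [NormedAddCommGroup X] [NormedSpace ℝ X] [CompleteSpace X]
    (hX : ∀ f ∈ (Metric.closedBall (0 : StrongDual ℝ X) 1).extremePoints ℝ,
      IsLSummand (Submodule.span ℝ {f}))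
    (x : X) (hx : ‖x‖ = 1) (hvs : IsVerySmoothPoint x) :
    IsQPPoint x ∧
      (IsL1Predual.{u, v} X → ∀ n : ℕ, IsQPPoint (evenDualEmbedding X n x)) := by
  have hlin := hvs.normLocallyLinearAt hX
  exact ⟨hlin.isQPPoint hx, fun _ n =>
    (hlin.evenDualEmbedding n).isQPPoint (((evenDualEmbedding X n).norm_map x).trans hx)⟩
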